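/- Let $W$ be a unitary in the $n$-qubit Clifford group (a unitary whose conjugation action maps the Pauli group onto itself), and let $|\psi_0\rangle = W|0\rangle^{\otimes n}$. Consider a tableau of $|\psi_0\rangle$: a binary array with $2n$ rows $(x\,|\,z\,|\,r)$, $x,z\in\mathbb{Z}_2^n$, $r\in\mathbb{Z}_2$, each encoding the signed Pauli string $(-1)^r\bigotimes_j P_j$, where $P_j = I, Z, X, Y$ according as $x_jz_j = 00, 01, 10, 11$, such that the bottom $n$ rows generate the Pauli stabilizer group of $|\psi_0\rangle$ and all $2n$ rows together generate the Pauli group up to phases. Let $\overline{X}\in\mathbb{Z}_2^{n\times n}$ be the matrix formed by the $x$-parts of the bottom $n$ rows. For $0\le x<2^n$ let $\mathbf{u}_x\in\mathbb{Z}_2^n$ be the $n$-bit representation of $x$, and let $J_K=\{\mathbf{u}\in\mathbb{Z}_2^n : |\langle\psi_0|\mathbf{u}\rangle|^2\neq 0\}$ be the set of basis states with nonzero amplitude. Suppose that $|\langle\psi_0|\mathbf{u}_{x_0}\rangle|^2\ne 0$. Then, for every matrix $\mathbf{R}\in\mathbb{Z}_2^{n\times r}$ whose columns span the row space of $\overline{X}$,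 $$J_K=\{\mathbf{R}\mathbf{z}+\mathbf{u}_{x_0} : \mathbf{z}\in\mathbb{Z}_2^r\},$$ and if $\mathbf{R}$ has rank $r$, then $r=\operatorname{rank}(\overline{X})$; such an $\mathbf{R}$ of rank $r=\operatorname{rank}(\overline{X})$ exists. Moreover, whenever $|\psi_0\rangle$ is written, up to a global phase, as $$\frac{1}{2^{r/2}}\sum_{\mathbf{z}\in\mathbb{Z}_2^r} i^{\,2\mathbf{c}^\intercal f(\mathbf{z})+f(\mathbf{z})^\intercal \mathbf{Q} f(\mathbf{z})}\,|f(\mathbf{z})\rangle,\qquad f(\mathbf{z})=\mathbf{R}\mathbf{z}+\mathbf{t},$$ with $\mathbf{c},\mathbf{t}\in\mathbb{Z}_2^n$, a symmetric $\mathbf{Q}\in\mathbb{Z}_2^{n\times n}$ and $\mathbf{R}\in\mathbb{Z}_2^{n\times r}$ of rank $r$ (the exponent being computed with the bits taken as the integers $0,1$), one has $J_K=\{\mathbf{R}\mathbf{z}+\mathbf{t} : \mathbf{z}\in\mathbb{Z}_2^r\}$ and $r=\operatorname{rank}(\overline{X})$. -/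

import Mathlib

open Matrix

noncomputable section

namespace Stab

/-- Labels `u ∈ ℤ₂ⁿ` of the computational basis states of `n` qubits. -/
abbrev Bits (n : ℕ) : Type := Fin n → ZMod 2

/-- State vectors of `n` qubits: coordinates in the computational basis. -/
abbrev State (n : ℕ) : Type := Bits n → ℂ

/-- Operators on `n` qubits, as matrices in the computational basis. -/
abbrev Op (n : ℕ) : Type := Matrix (Bits n) (Bits n) ℂ

/-- The `n`-bit representation `u_x` of an integer `0 ≤ x < 2ⁿ`, most significant bit first. -/
def bits {n : ℕ} (x : Fin (2 ^ n)) : Bits n :=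
  fun j => if x.val.testBit (n - 1 - j.val) then 1 else 0

/-- The basis state `|u⟩`. -/
def ket {n : ℕ} (u : Bits n) : State n := Pi.single u 1

/-- The Hermitian inner product `⟨φ|ψ⟩`, conjugate linear in the first argument. -/
def braket {n : ℕ} (φ ψ : State n) : ℂ := star φ ⬝ᵥ ψ

/-- The one-qubit Pauli matrix encoded by the bits `x z`:
`00 ↦ I`, `01 ↦ Z`, `10 ↦ X`, `11 ↦ Y`. Rows and columns are indexed by the bits `0`, `1`. -/
def pauli (x z : ZMod 2) : Matrix (ZMod 2) (ZMod 2) ℂ :=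
  if x = 0 then
    if z = 0 then 1 else Matrix.diagonal fun a => if a = 0 then 1 else -1
  else
    if z = 0 then Matrix.of fun a b => if a = b then 0 else 1
    else Matrix.of fun a b => if a = b then 0 else if a = 0 then -Complex.I else Complex.I

/-- The Pauli string (tensor product of one-qubit Pauli matrices) whose `j`-th factor is encoded by
the bits `x j`, `z j`. -/
def pauliString {n : ℕ} (x z : Bits n) : Op n :=
  Matrix.of fun u v => ∏ j, pauli (x j) (z j) (u j) (v j)

/-- The `n`-qubit Pauli group: Pauli strings with a phase in `{1, i, -1, -i}`. -/
def pauliGroup (n : ℕ) : Set (Op n) :=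
  {g | ∃ (k : ℕ) (x z : Bits n), g = Complex.I ^ k • pauliString x z}

/-- `W` belongs to the `n`-qubit Clifford group: it is unitary and conjugation by it maps the Pauli
group onto itself. -/
def IsClifford {n : ℕ} (W : Op n) : Prop :=
  W ∈ Matrix.unitaryGroup (Bits n) ℂ ∧
    (fun g : Op n => W * g * Wᴴ) '' pauliGroup n = pauliGroup n

/-- The Pauli stabilizer group of a state: the elements of the Pauli group that fix it. -/
def stabilizer {n : ℕ} (ψ : State n) : Set (Op n) :=
  {g | g ∈ pauliGroup n ∧ g *ᵥ ψ = ψ}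

/-- A binary tableau with `2n` rows `(x | z | r)`. Rows `Sum.inl i` are the top `n` rows, rows
`Sum.inr i` the bottom `n` rows. -/
structure Tableau (n : ℕ) where
  /-- The left block. -/
  X : Matrix (Fin n ⊕ Fin n) (Fin n) (ZMod 2)
  /-- The middle block. -/
  Z : Matrix (Fin n ⊕ Fin n) (Fin n) (ZMod 2)
  /-- The sign column. -/
  S : Fin n ⊕ Fin n → ZMod 2

namespace Tableau

/-- The signed Pauli string encoded by a row of a tableau. -/
def rowOp {n : ℕ} (τ : Tableau n) (i : Fin n ⊕ Fin n) : Op n :=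
  (-1 : ℂ) ^ (τ.S i).val • pauliString (τ.X i) (τ.Z i)

/-- The last `n` rows of the `X` block of a tableau. -/
def Xbar {n : ℕ} (τ : Tableau n) : Matrix (Fin n) (Fin n) (ZMod 2) :=
  Matrix.of fun i => τ.X (Sum.inr i)

/-- `τ` is a tableau of the state `ψ`: the bottom rows generate the stabilizer group of `ψ`, and
all the rows together generate the whole Pauli group up to phases. (Signed Pauli strings are their
own inverses, so the generated group is the generated monoid. The commutation relations between
destabilizers and stabilizers are not required.) -/
def Represents {n : ℕ} (τ : Tableau n) (ψ : State n) : Prop :=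
  (Submonoid.closure (Set.range fun i : Fin n => τ.rowOp (Sum.inr i)) : Set (Op n)) =
      stabilizer ψ ∧
    ∀ g ∈ pauliGroup n, ∃ k : ℕ, Complex.I ^ k • g ∈ Submonoid.closure (Set.range τ.rowOp)

end Tableau

/-- The set `J_K` of (labels of) basis states with nonzero amplitude in `ψ`. -/
def supportSet {n : ℕ} (ψ : State n) : Set (Bits n) :=
  {u | ‖braket ψ (ket u)‖ ^ 2 ≠ 0}

/-- The affine set `{R z + t : z ∈ ℤ₂ʳ}`. -/
def affineSet {n r : ℕ} (R : Matrix (Fin n) (Fin r) (ZMod 2)) (t : Bits n) : Set (Bits n) :=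
  {u | ∃ z : Bits r, u = R *ᵥ z + t}

/-- The column space of a binary matrix. -/
def colSpace {m r : ℕ} (A : Matrix (Fin m) (Fin r) (ZMod 2)) : Submodule (ZMod 2) (Bits m) :=
  Submodule.span (ZMod 2) (Set.range fun j => fun i => A i j)

/-- The row space of a binary matrix. -/
def rowSpace {m r : ℕ} (A : Matrix (Fin m) (Fin r) (ZMod 2)) : Submodule (ZMod 2) (Bits r) :=
  Submodule.span (ZMod 2) (Set.range fun i => A i)

/-- The exponent `2 cᵀf + fᵀ Q f`, computed with the bits as integers `0`, `1`. -/
def phaseExponent {n : ℕ} (c : Bits n) (Q : Matrix (Fin n) (Fin n) (ZMod 2)) (f : Bits n) : ℕ :=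
  2 * ∑ j, (c j).val * (f j).val + ∑ i, ∑ j, (f i).val * (Q i j).val * (f j).val

/-- `ψ` is written in affine form with data `R` of rank `r` and `t`: up to a global phase, `ψ` is
`2^(-r/2) ∑_z i^(2 cᵀf(z) + f(z)ᵀ Q f(z)) |f(z)⟩`, where `f(z) = R z + t`, for some binary vector
`c` and some symmetric binary matrix `Q`. -/
def IsAffineForm {n r : ℕ} (ψ : State n) (R : Matrix (Fin n) (Fin r) (ZMod 2)) (t : Bits n) :
    Prop :=
  R.rank = r ∧
    ∃ (c : Bits n) (Q : Matrix (Fin n) (Fin n) (ZMod 2)) (ω : ℂ), Q.IsSymm ∧ ‖ω‖ = 1 ∧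
      ψ = (ω * ((Real.sqrt (2 ^ r) : ℝ) : ℂ)⁻¹) •
        ∑ z : Bits r, Complex.I ^ phaseExponent c Q (R *ᵥ z + t) • ket (R *ᵥ z + t)

end Stab

end

namespace Stab

/-! Up to nonzero factors, a Pauli operator translates the basis labels by its x-part, and x-parts
add under products. The stabilizer group therefore realizes exactly the translations by the row
space V of `Xbar`, and the support is a union of V-cosets (`add_mem_supportSet`).

There is only one coset. If u - u₀ is not in V, some z is orthogonal to V but not to u - u₀. Then
Z^z commutes with the stabilizers W Z^y Wᴴ, so Wᴴ Z^z W is a Pauli operator commuting with every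
Z^y, hence diagonal. Thus W|0⟩ is an eigenvector of Z^z (`exists_eigenvalue_of_commute`), and
(-1)^(z ⬝ v) is constant for v in the support, a contradiction.

The rest is linear algebra: an affine set determines its direction space, hence the rank. -/

/-- The nonzero entries of `g` are exactly those in the positions `(v + x, v)`. -/
def HasShift {n : ℕ} (g : Op n) (x : Bits n) : Prop :=
  ∀ u v, g u v ≠ 0 ↔ u = v + x

/-- The sign `(-1)^(z ⬝ u)` by which the string `Z^z` acts on `|u⟩`. -/
def zSign {n : ℕ} (z u : Bits n) : ℂ := ∏ j, if z j * u j = 0 then 1 else -1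

/-! ### Pauli operators as translations of labels -/

theorem eq_zero_or_eq_one (a : ZMod 2) : a = 0 ∨ a = 1 := by
  revert a
  decide

theorem sign_add (a b : ZMod 2) :
    (if a + b = 0 then (1 : ℂ) else -1) =
      (if a = 0 then 1 else -1) * if b = 0 then 1 else -1 := by
  obtain rfl | rfl := eq_zero_or_eq_one a <;> obtain rfl | rfl := eq_zero_or_eq_one b <;>
    simp [CharTwo.add_self_eq_zero]

theorem pauli_ne_zero_iff (x z a b : ZMod 2) : pauli x z a b ≠ 0 ↔ a = b + x := by
  obtain rfl | rfl := eq_zero_or_eq_one x <;> obtain rfl | rfl := eq_zero_or_eq_one z <;>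
    obtain rfl | rfl := eq_zero_or_eq_one a <;> obtain rfl | rfl := eq_zero_or_eq_one b <;>
    simp [pauli, CharTwo.add_self_eq_zero]

theorem hasShift_pauliString {n : ℕ} (x z : Bits n) : HasShift (pauliString x z) x := by
  intro u v
  simp only [pauliString, Matrix.of_apply, Finset.prod_ne_zero_iff, pauli_ne_zero_iff,
    Finset.mem_univ, true_implies, funext_iff, Pi.add_apply]

theorem HasShift.smul {n : ℕ} {g : Op n} {x : Bits n} (h : HasShift g x) {c : ℂ} (hc : c ≠ 0) :
    HasShift (c • g) x := by
  intro u v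
  rw [← h u v]
  simp [hc]

theorem hasShift_one {n : ℕ} : HasShift (1 : Op n) 0 := by
  intro u v
  simp [Matrix.one_apply]

theorem HasShift.apply_eq_zero {n : ℕ} {g : Op n} {x : Bits n} (h : HasShift g x) {u v : Bits n}
    (huv : u ≠ v + x) : g u v = 0 := by
  by_contra h0
  exact huv ((h u v).1 h0)

theorem HasShift.mul {n : ℕ} {g h : Op n} {x y : Bits n} (hg : HasShift g x) (hh : HasShift h y) :
    HasShift (g * h) (x + y) := by
  intro u v
  rw [Matrix.mul_apply, Finset.sum_eq_single (u - x), mul_ne_zero_iff, hg, hh]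
  · rw [sub_add_cancel, sub_eq_iff_eq_add, add_right_comm, add_assoc]
    simp
  · intro w _ hw
    rw [hg.apply_eq_zero (fun h => hw (by rw [h, add_sub_cancel_right])), zero_mul]
  · simp

theorem HasShift.mulVec_apply {n : ℕ} {g : Op n} {x : Bits n} (h : HasShift g x) (ψ : State n)
    (u : Bits n) : (g *ᵥ ψ) u = g u (u - x) * ψ (u - x) := by
  rw [Matrix.mulVec, dotProduct, Finset.sum_eq_single (u - x)]
  · intro w _ hw
    rw [h.apply_eq_zero (fun h => hw (by rw [h, add_sub_cancel_right])), zero_mul]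
  · simp

theorem exists_hasShift_of_mem_pauliGroup {n : ℕ} {g : Op n} (hg : g ∈ pauliGroup n) :
    ∃ x, HasShift g x := by
  obtain ⟨k, x, z, rfl⟩ := hg
  exact ⟨x, (hasShift_pauliString x z).smul (pow_ne_zero _ Complex.I_ne_zero)⟩

theorem pauliString_mem_pauliGroup {n : ℕ} (x z : Bits n) : pauliString x z ∈ pauliGroup n :=
  ⟨0, x, z, by simp⟩

theorem hasShift_rowOp {n : ℕ} (τ : Tableau n) (i : Fin n ⊕ Fin n) :
    HasShift (τ.rowOp i) (τ.X i) :=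
  (hasShift_pauliString _ _).smul (pow_ne_zero _ (by norm_num))

theorem exists_hasShift_of_mem_closure {n : ℕ} (τ : Tableau n) {g : Op n}
    (hg : g ∈ Submonoid.closure (Set.range fun i : Fin n => τ.rowOp (Sum.inr i))) :
    ∃ x ∈ rowSpace τ.Xbar, HasShift g x := by
  induction hg using Submonoid.closure_induction with
  | mem g hg =>
    obtain ⟨i, rfl⟩ := hg
    exact ⟨_, Submodule.subset_span ⟨i, rfl⟩, hasShift_rowOp τ _⟩
  | one => exact ⟨0, zero_mem _, hasShift_one⟩
  | mul g h _ _ hg hh =>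
    obtain ⟨x, hx, hgx⟩ := hg
    obtain ⟨y, hy, hhy⟩ := hh
    exact ⟨x + y, add_mem hx hy, hgx.mul hhy⟩

theorem exists_mem_closure_hasShift {n : ℕ} (τ : Tableau n) {x : Bits n}
    (hx : x ∈ rowSpace τ.Xbar) :
    ∃ g ∈ Submonoid.closure (Set.range fun i : Fin n => τ.rowOp (Sum.inr i)), HasShift g x := by
  induction hx using Submodule.span_induction with
  | mem x hx =>
    obtain ⟨i, rfl⟩ := hx
    exact ⟨_, Submonoid.subset_closure ⟨i, rfl⟩, hasShift_rowOp τ _⟩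
  | zero => exact ⟨1, one_mem _, hasShift_one⟩
  | add x y _ _ hx hy =>
    obtain ⟨g, hg, hgx⟩ := hx
    obtain ⟨h, hh, hhy⟩ := hy
    exact ⟨g * h, mul_mem hg hh, hgx.mul hhy⟩
  | smul c x _ hx =>
    -- The only scalars are 0 and 1, so products of rows already reach the whole span.
    obtain rfl | rfl := eq_zero_or_eq_one c
    · exact ⟨1, one_mem _, by simpa using hasShift_one⟩
    · simpa using hx

theorem mem_supportSet {n : ℕ} {ψ : State n} {u : Bits n} : u ∈ supportSet ψ ↔ ψ u ≠ 0 := by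
  simp [supportSet, braket, ket]

/-! ### Z-strings as characters, and commutation -/

theorem pauliString_zero_left {n : ℕ} (z : Bits n) :
    pauliString 0 z = Matrix.diagonal (zSign z) := by
  ext u v
  by_cases h : u = v
  · subst h
    simp only [pauliString, Matrix.of_apply, Matrix.diagonal_apply_eq, zSign, Pi.zero_apply]
    refine Finset.prod_congr rfl fun j _ => ?_
    generalize z j = a
    generalize u j = b
    obtain rfl | rfl := eq_zero_or_eq_one a <;> obtain rfl | rfl := eq_zero_or_eq_one b <;>
      simp [pauli]
  · rw [Matrix.diagonal_apply_ne _ h]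
    exact (hasShift_pauliString 0 z).apply_eq_zero (by simpa using h)

theorem zSign_add {n : ℕ} (z u v : Bits n) : zSign z (u + v) = zSign z u * zSign z v := by
  simp only [zSign, ← Finset.prod_mul_distrib, Pi.add_apply, mul_add, sign_add]

theorem zSign_eq {n : ℕ} (z u : Bits n) : zSign z u = if z ⬝ᵥ u = 0 then 1 else -1 := by
  have key : ∀ s : Finset (Fin n), (∏ j ∈ s, if z j * u j = 0 then (1 : ℂ) else -1) =
      if ∑ j ∈ s, z j * u j = 0 then 1 else -1 := by
    intro s
    induction s using Finset.induction_on with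
    | empty => simp
    | insert a s ha ih =>
      rw [Finset.prod_insert ha, Finset.sum_insert ha, ih,
        sign_add]
  exact key _

theorem zSign_ne_zero {n : ℕ} (z u : Bits n) : zSign z u ≠ 0 := by
  rw [zSign_eq]
  split_ifs <;> norm_num

/-- Moving the diagonal past a translation by x multiplies every nonzero entry by the character
value (-1)^(z ⬝ x). -/
theorem HasShift.commute_diagonal_zSign_iff {n : ℕ} {g : Op n} {x : Bits n} (h : HasShift g x)
    (z : Bits n) : Commute (Matrix.diagonal (zSign z)) g ↔ z ⬝ᵥ x = 0 := by
  have hx : z ⬝ᵥ x = 0 ↔ zSign z x = 1 := by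
    rw [zSign_eq]
    split_ifs with h0
    · simp [h0]
    · simp only [h0, false_iff]
      norm_num
  rw [hx, Commute, SemiconjBy]
  constructor
  · intro hc
    -- The entry (x, 0) is nonzero, and the character is 1 at the label 0.
    have := congrFun (congrFun hc x) 0
    rw [Matrix.diagonal_mul, Matrix.mul_diagonal, mul_comm] at this
    have h1 := mul_left_cancel₀ ((h x 0).2 (by simp)) this
    rw [h1, zSign_eq]
    simp
  · intro hc
    ext u v
    rw [Matrix.diagonal_mul, Matrix.mul_diagonal]
    by_cases huv : u = v + x
    · rw [huv, zSign_add, hc, mul_one, mul_comm]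
    · rw [h.apply_eq_zero huv]
      simp

theorem add_mem_supportSet {n : ℕ} {ψ : State n} {g : Op n} {x u : Bits n} (hg : HasShift g x)
    (hψ : g *ᵥ ψ = ψ) (hu : u ∈ supportSet ψ) : u + x ∈ supportSet ψ := by
  rw [mem_supportSet] at hu ⊢
  rw [← hψ, hg.mulVec_apply, add_sub_cancel_right]
  exact mul_ne_zero ((hg _ _).2 rfl) hu

/-- A functional separates w from V; its values on the standard basis form the vector z. -/
theorem exists_dotProduct_eq_zero_of_notMem {n : ℕ} (V : Submodule (ZMod 2) (Bits n)) {w : Bits n}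
    (hw : w ∉ V) : ∃ z : Bits n, (∀ v ∈ V, z ⬝ᵥ v = 0) ∧ z ⬝ᵥ w ≠ 0 := by
  obtain ⟨f, hf, hV⟩ := Submodule.exists_le_ker_of_notMem hw
  have hfz : ∀ v, (fun j => f (Pi.single j 1)) ⬝ᵥ v = f v := by
    intro v
    conv_rhs => rw [LinearMap.pi_apply_eq_sum_univ f v]
    simp only [dotProduct, smul_eq_mul]
    refine Finset.sum_congr rfl fun j _ => ?_
    rw [mul_comm]
    congr 2
    ext i
    simp [Pi.single_apply, eq_comm]
  refine ⟨fun j => f (Pi.single j 1), fun v hv => ?_, ?_⟩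
  · rw [hfz]
    exact hV hv
  · rwa [hfz]

/-! ### The support of a Clifford state is a single coset -/

/-- A string `Z^z` that commutes with the conjugates of all `Z`-strings under a Clifford `W` has
`W|0⟩` as an eigenvector. -/
theorem exists_eigenvalue_of_commute {n : ℕ} {W : Op n} (hW : IsClifford W) (z : Bits n)
    (hz : ∀ y, Commute (Matrix.diagonal (zSign z)) (W * pauliString 0 y * Wᴴ)) :
    ∃ c : ℂ, Matrix.diagonal (zSign z) *ᵥ (W *ᵥ ket 0) = c • (W *ᵥ ket 0) := by
  have hWW : Wᴴ * W = 1 := (Matrix.mem_unitaryGroup_iff' (A := W)).1 hW.1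
  have hmem : Matrix.diagonal (zSign z) ∈ (fun g : Op n => W * g * Wᴴ) '' pauliGroup n := by
    rw [hW.2, ← pauliString_zero_left]
    exact pauliString_mem_pauliGroup _ _
  obtain ⟨h, hh, hZ⟩ := hmem
  obtain ⟨x, hx⟩ := exists_hasShift_of_mem_pauliGroup hh
  have hconj : ∀ a b : Op n, (W * a * Wᴴ) * (W * b * Wᴴ) = W * (a * b) * Wᴴ := by
    intro a b
    calc (W * a * Wᴴ) * (W * b * Wᴴ) = W * a * (Wᴴ * W) * b * Wᴴ := by simp only [mul_assoc]
      _ = _ := by rw [hWW, mul_one]; simp only [mul_assoc]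
  have hinv : ∀ a : Op n, Wᴴ * (W * a * Wᴴ) * W = a := by
    intro a
    calc Wᴴ * (W * a * Wᴴ) * W = (Wᴴ * W) * a * (Wᴴ * W) := by simp only [mul_assoc]
      _ = a := by rw [hWW, one_mul, mul_one]
  have hcomm : ∀ y, Commute (Matrix.diagonal (zSign y)) h := by
    intro y
    have h1 := (hz y).eq
    simp only [← hZ, hconj] at h1
    have h2 := congrArg (fun a => Wᴴ * a * W) h1
    simp only [hinv] at h2
    rw [← pauliString_zero_left]
    exact h2.symm
  -- Commuting with Z on qubit j alone forces the j-th bit of the shift to vanish.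
  have hx0 : x = 0 := by
    ext j
    simpa using (hx.commute_diagonal_zSign_iff _).1 (hcomm (Pi.single j 1))
  subst hx0
  refine ⟨h 0 0, ?_⟩
  have hket : h *ᵥ ket 0 = h 0 0 • ket 0 := by
    ext u
    rw [hx.mulVec_apply, sub_zero]
    by_cases hu : u = 0
    · subst hu
      simp [ket]
    · simp [ket, hu]
  rw [← hZ, Matrix.mulVec_mulVec, mul_assoc, hWW, mul_one, ← Matrix.mulVec_mulVec, hket,
    Matrix.mulVec_smul]

/-- Every Z-string fixes |0⟩, so its conjugate by W fixes W|0⟩. -/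
theorem conj_zString_mem_stabilizer {n : ℕ} {W : Op n} (hW : IsClifford W) (y : Bits n) :
    W * pauliString 0 y * Wᴴ ∈ stabilizer (W *ᵥ ket 0) := by
  have hWW : Wᴴ * W = 1 := (Matrix.mem_unitaryGroup_iff' (A := W)).1 hW.1
  refine ⟨?_, ?_⟩
  · rw [← hW.2]
    exact ⟨_, pauliString_mem_pauliGroup _ _, rfl⟩
  · rw [Matrix.mulVec_mulVec, mul_assoc, hWW, mul_one, ← Matrix.mulVec_mulVec]
    congr 1
    ext u
    rw [pauliString_zero_left, Matrix.mulVec_diagonal]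
    by_cases hu : u = 0
    · subst hu
      simp [ket, zSign_eq]
    · simp [ket, hu]

/-- The support of a stabilizer state is a coset of the row space of the stabilizer `X` block. -/
theorem mem_supportSet_iff_sub_mem_rowSpace {n : ℕ} {W : Op n} (hW : IsClifford W)
    {τ : Tableau n} (hτ : τ.Represents (W *ᵥ ket 0)) {u₀ : Bits n}
    (hu₀ : u₀ ∈ supportSet (W *ᵥ ket 0)) (u : Bits n) :
    u ∈ supportSet (W *ᵥ ket 0) ↔ u - u₀ ∈ rowSpace τ.Xbar := by
  constructor
  · intro hu
    by_contra hV
    obtain ⟨z, hzV, hz⟩ := exists_dotProduct_eq_zero_of_notMem _ hV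
    obtain ⟨c, hc⟩ := exists_eigenvalue_of_commute hW z fun y => by
      -- As a stabilizer, this conjugate is a product of bottom rows, so its shift lies in the row
      -- space, which z annihilates.
      have hy := conj_zString_mem_stabilizer hW y
      rw [← hτ.1] at hy
      obtain ⟨x, hx, hs⟩ := exists_hasShift_of_mem_closure τ hy
      exact (hs.commute_diagonal_zSign_iff z).2 (hzV x hx)
    have key : ∀ v ∈ supportSet (W *ᵥ ket 0), zSign z v = c := by
      intro v hv
      have := congrFun hc v
      rw [Matrix.mulVec_diagonal, Pi.smul_apply, smul_eq_mul] at this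
      exact mul_right_cancel₀ (mem_supportSet.1 hv) this
    have h1 : zSign z u = zSign z u₀ := (key u hu).trans (key u₀ hu₀).symm
    rw [← sub_add_cancel u u₀, zSign_add] at h1
    have h2 := mul_right_cancel₀ (zSign_ne_zero z u₀) (h1.trans (one_mul _).symm)
    rw [zSign_eq, if_neg hz] at h2
    norm_num at h2
  · intro hu
    obtain ⟨g, hg, hs⟩ := exists_mem_closure_hasShift τ hu
    have hgS : g ∈ stabilizer (W *ᵥ ket 0) := by
      rw [← hτ.1]
      exact hg
    simpa using add_mem_supportSet hs hgS.2 hu₀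

/-! ### Affine sets, ranks and affine forms -/

theorem colSpace_eq_range {m r : ℕ} (A : Matrix (Fin m) (Fin r) (ZMod 2)) :
    colSpace A = LinearMap.range A.mulVecLin := by
  rw [Matrix.range_mulVecLin]
  rfl

theorem mem_affineSet {n r : ℕ} {R : Matrix (Fin n) (Fin r) (ZMod 2)} {t u : Bits n} :
    u ∈ affineSet R t ↔ u - t ∈ colSpace R := by
  rw [colSpace_eq_range]
  simp only [affineSet, Set.mem_ofPred_eq, LinearMap.mem_range, Matrix.mulVecLin_apply]
  exact exists_congr fun z => by rw [eq_sub_iff_add_eq, eq_comm]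

theorem finrank_colSpace {m r : ℕ} (A : Matrix (Fin m) (Fin r) (ZMod 2)) :
    Module.finrank (ZMod 2) (colSpace A) = A.rank := by
  rw [colSpace_eq_range]
  rfl

theorem finrank_rowSpace {m r : ℕ} (A : Matrix (Fin m) (Fin r) (ZMod 2)) :
    Module.finrank (ZMod 2) (rowSpace A) = A.rank :=
  (Matrix.rank_eq_finrank_span_row A).symm

theorem exists_colSpace_eq {n r : ℕ} (V : Submodule (ZMod 2) (Bits n))
    (hV : Module.finrank (ZMod 2) V = r) :
    ∃ R : Matrix (Fin n) (Fin r) (ZMod 2), colSpace R = V := by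
  let b := Module.finBasisOfFinrankEq (ZMod 2) V hV
  refine ⟨Matrix.of fun i j => (b j : Bits n) i, ?_⟩
  have h := congrArg (Submodule.map V.subtype) b.span_eq
  rw [Submodule.map_span, Submodule.map_top, Submodule.range_subtype, ← Set.range_comp] at h
  exact h

/-- The two base points differ by an element of the column space, so changing the base point does
not affect the direction space. -/
theorem colSpace_eq_of_affineSet_eq {n r : ℕ} {R : Matrix (Fin n) (Fin r) (ZMod 2)}
    {t u₀ : Bits n} {V : Submodule (ZMod 2) (Bits n)}
    (h : ∀ u, u ∈ affineSet R t ↔ u - u₀ ∈ V) : colSpace R = V := by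
  have h0 : u₀ - t ∈ colSpace R := by
    rw [← mem_affineSet, h, sub_self]
    exact zero_mem V
  ext w
  rw [← add_sub_cancel_right w u₀, ← h, mem_affineSet, add_sub_cancel_right, add_sub_assoc]
  exact (Submodule.add_mem_iff_left _ h0).symm

theorem mulVec_injective_of_rank_eq {n r : ℕ} {R : Matrix (Fin n) (Fin r) (ZMod 2)}
    (hR : R.rank = r) : Function.Injective R.mulVec := by
  have h := LinearMap.finrank_range_add_finrank_ker R.mulVecLin
  rw [Module.finrank_fin_fun] at h
  have h' : Module.finrank (ZMod 2) (LinearMap.range R.mulVecLin) = r := hR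
  have hker : LinearMap.ker R.mulVecLin = ⊥ := by
    rw [← Submodule.finrank_eq_zero]
    omega
  exact LinearMap.ker_eq_bot.1 hker

theorem IsAffineForm.supportSet_eq {n r : ℕ} {ψ : State n} {R : Matrix (Fin n) (Fin r) (ZMod 2)}
    {t : Bits n} (h : IsAffineForm ψ R t) : supportSet ψ = affineSet R t := by
  obtain ⟨hR, c, Q, ω, -, hω, rfl⟩ := h
  have hinj := mulVec_injective_of_rank_eq hR
  have hc : ω * ((Real.sqrt (2 ^ r) : ℝ) : ℂ)⁻¹ ≠ 0 := by
    refine mul_ne_zero ?_ (inv_ne_zero ?_)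
    · rintro rfl
      simp at hω
    · exact Complex.ofReal_ne_zero.2 (by positivity)
  ext u
  rw [mem_supportSet, Pi.smul_apply, smul_eq_mul, mul_ne_zero_iff, and_iff_right hc,
    Finset.sum_apply]
  constructor
  · intro hne
    obtain ⟨z, -, hz⟩ := Finset.exists_ne_zero_of_sum_ne_zero hne
    refine ⟨z, ?_⟩
    by_contra hu
    simp [ket, hu] at hz
  · rintro ⟨z, rfl⟩
    -- Full column rank makes the kets distinct, so no two terms can cancel.
    rw [Finset.sum_eq_single z]
    · simp [ket]
    · intro w _ hw
      have hne : R *ᵥ z + t ≠ R *ᵥ w + t := fun h => hw (hinj (add_right_cancel h)).symm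
      simp [ket, hne]
    · simp

end Stab

theorem theorem2 (n : ℕ) (W : Stab.Op n) (hW : Stab.IsClifford W)
    (ψ₀ : Stab.State n) (hψ₀ : ψ₀ = W *ᵥ Stab.ket 0)
    (τ : Stab.Tableau n) (hτ : τ.Represents ψ₀)
    (x₀ : Fin (2 ^ n)) (hx₀ : ‖Stab.braket ψ₀ (Stab.ket (Stab.bits x₀))‖ ^ 2 ≠ 0) :
    -- every `R` whose columns span the row space of the stabilizer `X` block gives the support;
    -- if `R` has full column rank `r`, then `r` is the rank of that block
    (∀ (r : ℕ) (R : Matrix (Fin n) (Fin r) (ZMod 2)),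
      Stab.colSpace R = Stab.rowSpace τ.Xbar →
        Stab.supportSet ψ₀ = Stab.affineSet R (Stab.bits x₀) ∧
          (R.rank = r → r = τ.Xbar.rank)) ∧
    -- such an `R` with exactly `rank` many independent columns exists
    (∃ R : Matrix (Fin n) (Fin τ.Xbar.rank) (ZMod 2),
      R.rank = τ.Xbar.rank ∧ Stab.colSpace R = Stab.rowSpace τ.Xbar) ∧
    -- the support and the number `r` are those of any affine form of the state
    (∀ (r : ℕ) (R : Matrix (Fin n) (Fin r) (ZMod 2)) (t : Stab.Bits n),
      Stab.IsAffineForm ψ₀ R t →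
        Stab.supportSet ψ₀ = Stab.affineSet R t ∧ r = τ.Xbar.rank) := by
  subst hψ₀
  have hsupp := Stab.mem_supportSet_iff_sub_mem_rowSpace hW hτ (u₀ := Stab.bits x₀) hx₀
  refine ⟨fun r R hR => ⟨?_, fun hr => ?_⟩, ?_, fun r R t hform => ⟨hform.supportSet_eq, ?_⟩⟩
  · ext u
    rw [hsupp, Stab.mem_affineSet, hR]
  · rw [← Stab.finrank_rowSpace, ← hR, Stab.finrank_colSpace, hr]
  · obtain ⟨R, hR⟩ := Stab.exists_colSpace_eq _ (Stab.finrank_rowSpace τ.Xbar)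
    exact ⟨R, by rw [← Stab.finrank_colSpace, hR, Stab.finrank_rowSpace], hR⟩
  · have hcol : Stab.colSpace R = Stab.rowSpace τ.Xbar :=
      Stab.colSpace_eq_of_affineSet_eq fun u => by rw [← hform.supportSet_eq, hsupp]
    rw [← Stab.finrank_rowSpace, ← hcol, Stab.finrank_colSpace, hform.1]
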